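/- Let $\mathbb D\subset\mathbb C$ be the open unit disc, $\mathbb T$ the unit circle, $m_{\mathbb D}(a,b)=\left|\frac{a-b}{1-\bar a b}\right|$ the Möbius distance on $\mathbb D$, and $\mathcal O(U,V)$ the set of holomorphic maps from $U$ to $V$. For a domain $D\subset\mathbb C^n$ and $z,w\in D$ let - $l_D(z,w)=\inf\{|\alpha|:\alpha\in\mathbb D,\ \exists\varphi\in\mathcal O(\mathbb D,D):\ \varphi(0)=z,\ \varphi(\alpha)=w\}$ (the Lempert function); - $k_D(z,w)=\inf\sum_{j=0}^{m-1}\tanh^{-1}l_D(p_j,p_{j+1})$, the infimum over all finite chains $z=p_0,p_1,\dots,p_m=w$ of points of $D$ (the Kobayashi pseudodistance, i.e. the largest pseudodistance not exceeding $\tanh^{-1}l_D$), and $k^*_D=\tanh k_D$; - $c^*_D(z,w)=\sup\{m_{\mathbb D}(f(z),f(w)):f\in\mathcal O(D,\mathbb D)\}$ (the Carathéodory function). Let $\mathcal L$ be the class of domains $D$ with $l_D=c^*_D$ on $D\times D$. Let $\sigma=(\sigma_1,\dots,\sigma_n):\mathbb C^n\to\mathbb C^n$, where $\sigma_k$ is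 the $k$-th elementary symmetric polynomial, let $\mathbb G_n=\sigma(\mathbb D^n)$ be the symmetrized polydisc, and for $z,w\in\mathbb G_n$ put $$m_{\mathbb G_n}(z,w)=\max_{\lambda\in\mathbb T}m_{\mathbb D}(f_\lambda(z),f_\lambda(w)),\qquad f_\lambda(z)=\frac{\sum_{j=1}^{n}jz_j\lambda^{j-1}}{n+\sum_{j=1}^{n-1}(n-j)z_j\lambda^j}.$$ For functions $u,v$ on $\mathbb G_n$ write $u\gneq v$ if $u(w)\ge v(w)$ for all $w\in\mathbb G_n$ and $u(w)>v(w)$ for at least one $w\in\mathbb G_n$. Then for every $n\ge 3$, $$l_{\mathbb G_n}(0,\cdot)\gneq k^*_{\mathbb G_n}(0,\cdot)\ge c^*_{\mathbb G_n}(0,\cdot)\gneq m_{\mathbb G_n}(0,\cdot).$$ In particular the Lempert and Carathéodory functions of $\mathbb G_n$ differ, i.e. $\mathbb G_n\notin\mathcal L$ for $n\ge 3$. -/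

import Mathlib

open scoped ComplexConjugate

noncomputable section

namespace SymPolydisc

/-- The open unit disc in `ℂ`. -/
def unitDisc : Set ℂ := Metric.ball 0 1

/-- The Möbius distance `|(a - b) / (1 - conj a * b)|` (used for points of the unit disc). -/
def moebiusDist (a b : ℂ) : ℝ := ‖(a - b) / (1 - conj a * b)‖

/-- `f` is a holomorphic map from the open set `U` to `V`. -/
def IsHolomorphicMap {E F : Type*} [NormedAddCommGroup E] [NormedSpace ℂ E]
    [NormedAddCommGroup F] [NormedSpace ℂ F] (f : E → F) (U : Set E) (V : Set F) : Prop :=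
  DifferentiableOn ℂ f U ∧ Set.MapsTo f U V

section Invariants

variable {E : Type*} [NormedAddCommGroup E] [NormedSpace ℂ E]

/-- The Lempert function of a domain `D`: the infimum of `|α|` over all holomorphic discs
`φ : 𝔻 → D` and `α ∈ 𝔻` with `φ 0 = z`, `φ α = w`. -/
def lempert (D : Set E) (z w : E) : ℝ :=
  sInf {r : ℝ | ∃ (φ : ℂ → E) (α : ℂ), IsHolomorphicMap φ unitDisc D ∧ α ∈ unitDisc ∧
    φ 0 = z ∧ φ α = w ∧ r = ‖α‖}

/-- The Kobayashi pseudodistance of a domain `D`, the largest pseudodistance on `D` not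
exceeding `artanh` of the Lempert function: the infimum, over all finite chains
`z = p 0, p 1, …, p m = w` of points of `D`, of the sums of `artanh (l_D (p j, p (j + 1)))`. -/
def kobayashi (D : Set E) (z w : E) : ℝ :=
  sInf {r : ℝ | ∃ (m : ℕ) (p : ℕ → E), p 0 = z ∧ p m = w ∧ (∀ j ≤ m, p j ∈ D) ∧
    r = ∑ j ∈ Finset.range m, Real.artanh (lempert D (p j) (p (j + 1)))}

/-- The function `k* = tanh k`. -/
def kobayashiStar (D : Set E) (z w : E) : ℝ := Real.tanh (kobayashi D z w)

/-- The Carathéodory function `c*` of a domain `D`: the supremum of the Möbius distance between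
`f z` and `f w` over all holomorphic `f : D → 𝔻`. -/
def caratheodoryStar (D : Set E) (z w : E) : ℝ :=
  sSup {r : ℝ | ∃ f : E → ℂ, IsHolomorphicMap f D unitDisc ∧ r = moebiusDist (f z) (f w)}

/-- The defining property of the class `𝓛`: the Lempert function and the Carathéodory function
of the domain `D` coincide on `D × D`. -/
def MemLempertClass (D : Set E) : Prop :=
  ∀ z ∈ D, ∀ w ∈ D, lempert D z w = caratheodoryStar D z w

end Invariants

/-- The symmetrization map `σ : ℂⁿ → ℂⁿ`; the coordinate with (zero-based) index `k` is the
elementary symmetric polynomial of degree `k + 1`. -/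
def symMap (n : ℕ) (z : Fin n → ℂ) : Fin n → ℂ := fun k =>
  ∑ s ∈ Finset.powersetCard ((k : ℕ) + 1) (Finset.univ : Finset (Fin n)), ∏ i ∈ s, z i

/-- The symmetrized polydisc `G_n = σ(𝔻ⁿ)`. -/
def symPolydisc (n : ℕ) : Set (Fin n → ℂ) :=
  symMap n '' {z | ∀ i, z i ∈ unitDisc}

/-- The rational functions
`f_λ(z) = (∑_{j=1}^n j z_j λ^(j-1)) / (n + ∑_{j=1}^{n-1} (n - j) z_j λ^j)`,
written with zero-based indices `k = j - 1` (the term `j = n` of the second sum vanishes). -/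
def testFun (n : ℕ) (l : ℂ) (z : Fin n → ℂ) : ℂ :=
  (∑ k : Fin n, ((k : ℂ) + 1) * z k * l ^ (k : ℕ)) /
    ((n : ℂ) + ∑ k : Fin n, ((n : ℂ) - ((k : ℂ) + 1)) * z k * l ^ ((k : ℕ) + 1))

/-- The distance `m_{G_n}(z, w) = max_{|λ| = 1} m_𝔻(f_λ(z), f_λ(w))` on `G_n` (for points of
`G_n` the function of `λ` is continuous on the unit circle, so the supremum is a maximum). -/
def mDist (n : ℕ) (z w : Fin n → ℂ) : ℝ :=
  ⨆ l : Metric.sphere (0 : ℂ) 1, moebiusDist (testFun n l z) (testFun n l w)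

end SymPolydisc

end

noncomputable section

namespace SymPolydisc

/-! The non-strict inequalities are Schwarz-Pick: holomorphic maps into the disc contract along
analytic discs, hence along chains, and each `f_λ` maps `G_n` into the disc. There `f_λ = p'/(n p -
λ p')` at `λ`, with `p(t) = ∏ (1 + z_i t)`, and `λ p'/p` has real part below `n/2`.

Strictness `l > k*`. Going from `0` along the diagonal to `σ(s,…,s)` costs at most `s`. From there,
moving the points `s + (1 - s) ω^i η`, with `ω` a primitive `n`-th root of unity, changes only the
last coordinate of `σ`, linearly in `η^n`, so it costs at most `r^n` when `|η| = r`. Hence `k*` at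
the endpoint is below `t = s + r^n`. On the other hand, along a disc through `0` the roots are
`O(|ζ|^(1/n))`, so the power sum of degree `2n + 1` vanishes to order 3 and is at most `n |α|^3`. At
the endpoint it is at least `n (2n + 1) s ((1 - s) r)^(2n)`. Under `s + r^n = t` the product `s
r^(2n)` is maximal at `s = t/3`, with value `4 t^3 / 27`. Since `4 (2n + 1) ≥ 28 > 27` for `n ≥ 3`,
small `t` gives `l ≥ t`.

Strictness `c* > m`. As `k = n - 1` does not divide `n`, subtracting a multiple of `∑ p_j p_(k-j)`
from the power sum `p_k` lowers its supremum from `n` to some bound `M < n`, without changing it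
where `p_1, …, p_(k-1)` vanish. At the roots `0` and `β ω^i`, now with `ω` a primitive `k`-th root
of unity, this gives `c* ≥ k β^k / M`, whereas `m ≤ k β^k / (n - β^k)`; take `β` small. -/

theorem mem_unitDisc {z : ℂ} : z ∈ unitDisc ↔ ‖z‖ < 1 := by
  simp [unitDisc]

/-! ### The Möbius distance -/

/-- The involutive automorphism of the unit disc that exchanges `a` and `0`. -/
def moebius (a z : ℂ) : ℂ := (a - z) / (1 - conj a * z)

theorem one_sub_conj_mul_ne_zero {a b : ℂ} (ha : ‖a‖ < 1) (hb : ‖b‖ < 1) :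
    1 - conj a * b ≠ 0 := by
  intro h
  have h1 : ‖conj a * b‖ = 1 := by rw [← sub_eq_zero.mp h, norm_one]
  rw [norm_mul, RCLike.norm_conj] at h1
  nlinarith [norm_nonneg a, norm_nonneg b]

theorem moebiusDist_eq_norm_moebius (a b : ℂ) : moebiusDist a b = ‖moebius a b‖ := rfl

theorem moebiusDist_nonneg (a b : ℂ) : 0 ≤ moebiusDist a b := norm_nonneg _

theorem moebiusDist_zero_left (b : ℂ) : moebiusDist 0 b = ‖b‖ := by simp [moebiusDist]

theorem moebiusDist_comm (a b : ℂ) : moebiusDist a b = moebiusDist b a := by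
  unfold moebiusDist
  rw [norm_div, norm_div, norm_sub_rev a b, ← RCLike.norm_conj (1 - conj a * b)]
  simp [mul_comm]

theorem one_sub_moebiusDist_sq {a b : ℂ} (ha : ‖a‖ < 1) (hb : ‖b‖ < 1) :
    1 - moebiusDist a b ^ 2 =
      (1 - ‖a‖ ^ 2) * (1 - ‖b‖ ^ 2) / ‖1 - conj a * b‖ ^ 2 := by
  have h0 : ‖1 - conj a * b‖ ^ 2 ≠ 0 :=
    pow_ne_zero 2 (norm_ne_zero_iff.mpr (one_sub_conj_mul_ne_zero ha hb))
  rw [eq_div_iff h0, moebiusDist, norm_div, div_pow, sub_mul, div_mul_cancel₀ _ h0, one_mul]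
  simp only [Complex.sq_norm, Complex.normSq_apply, Complex.sub_re, Complex.sub_im,
    Complex.mul_re, Complex.mul_im, Complex.conj_re, Complex.conj_im, Complex.one_re,
    Complex.one_im]
  ring

theorem moebiusDist_lt_one {a b : ℂ} (ha : ‖a‖ < 1) (hb : ‖b‖ < 1) : moebiusDist a b < 1 := by
  have h0 : 0 < ‖1 - conj a * b‖ ^ 2 :=
    pow_pos (norm_pos_iff.mpr (one_sub_conj_mul_ne_zero ha hb)) 2
  have h1 := one_sub_moebiusDist_sq ha hb
  have h2 : 0 < (1 - ‖a‖ ^ 2) * (1 - ‖b‖ ^ 2) / ‖1 - conj a * b‖ ^ 2 := by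
    have := norm_nonneg a
    have := norm_nonneg b
    have : 0 < 1 - ‖a‖ ^ 2 := by nlinarith
    have : 0 < 1 - ‖b‖ ^ 2 := by nlinarith
    positivity
  nlinarith [moebiusDist_nonneg a b]

theorem norm_moebius_lt_one {a b : ℂ} (ha : ‖a‖ < 1) (hb : ‖b‖ < 1) : ‖moebius a b‖ < 1 :=
  moebiusDist_lt_one ha hb

theorem moebius_moebius {a b : ℂ} (ha : ‖a‖ < 1) (hb : ‖b‖ < 1) :
    moebius a (moebius a b) = b := by
  have h1 := one_sub_conj_mul_ne_zero ha hb
  have h2 := one_sub_conj_mul_ne_zero ha (norm_moebius_lt_one ha hb)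
  have h3 : 1 - conj a * a ≠ 0 := one_sub_conj_mul_ne_zero ha ha
  rw [moebius, div_eq_iff h2]
  unfold moebius
  generalize hd : 1 - conj a * b = d at *
  field_simp
  rw [← hd]
  ring

theorem moebiusDist_moebius {a b c : ℂ} (ha : ‖a‖ < 1) (hb : ‖b‖ < 1) (hc : ‖c‖ < 1) :
    moebiusDist (moebius a b) (moebius a c) = moebiusDist b c := by
  have h1 := one_sub_conj_mul_ne_zero ha hb
  have h2 := one_sub_conj_mul_ne_zero ha hc
  have h3 : 1 - conj a * a ≠ 0 := one_sub_conj_mul_ne_zero ha ha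
  have h4 : conj (1 - conj a * b) ≠ 0 := (map_ne_zero _).mpr h1
  have h5 := one_sub_conj_mul_ne_zero hb hc
  have e1 : moebius a b - moebius a c =
      (1 - conj a * a) * (c - b) / ((1 - conj a * b) * (1 - conj a * c)) := by
    unfold moebius
    generalize hd : 1 - conj a * b = d at *
    generalize he : 1 - conj a * c = e at *
    field_simp
    rw [← hd, ← he]
    ring
  have e2 : 1 - conj (moebius a b) * moebius a c =
      (1 - conj a * a) * (1 - conj b * c) / (conj (1 - conj a * b) * (1 - conj a * c)) := by
    have hd : conj (1 - conj a * b) = 1 - a * conj b := by simp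
    rw [moebius, map_div₀, map_sub, moebius]
    generalize conj (1 - conj a * b) = d at *
    generalize he : 1 - conj a * c = e at *
    field_simp
    rw [hd, ← he]
    ring
  have n1 := norm_ne_zero_iff.mpr h1
  have n2 := norm_ne_zero_iff.mpr h2
  have n3 := norm_ne_zero_iff.mpr h3
  have n5 := norm_ne_zero_iff.mpr h5
  simp only [moebiusDist, e1, e2, norm_div, norm_mul, RCLike.norm_conj, norm_sub_rev c b]
  generalize ‖1 - conj a * b‖ = x at *
  generalize ‖1 - conj a * c‖ = y at *
  generalize ‖1 - conj a * a‖ = u at *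
  generalize ‖1 - conj b * c‖ = v at *
  field_simp

/-- By `one_sub_moebiusDist_sq`, the distance grows with `|1 - conj p * q|`, which is at most `1 +
|p| |q|`. This is the triangle inequality through `0`. -/
theorem moebiusDist_le_of_norm {p q : ℂ} (hp : ‖p‖ < 1) (hq : ‖q‖ < 1) :
    moebiusDist p q ≤ (‖p‖ + ‖q‖) / (1 + ‖p‖ * ‖q‖) := by
  have hp0 := norm_nonneg p
  have hq0 := norm_nonneg q
  have h0 : 0 < ‖1 - conj p * q‖ := norm_pos_iff.mpr (one_sub_conj_mul_ne_zero hp hq)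
  have h1 := one_sub_moebiusDist_sq hp hq
  have h2 : ‖1 - conj p * q‖ ≤ 1 + ‖p‖ * ‖q‖ := by
    refine (norm_sub_le _ _).trans ?_
    simp
  have h3 : (1 - ‖p‖ ^ 2) * (1 - ‖q‖ ^ 2) / (1 + ‖p‖ * ‖q‖) ^ 2 ≤
      (1 - ‖p‖ ^ 2) * (1 - ‖q‖ ^ 2) / ‖1 - conj p * q‖ ^ 2 := by
    have : 0 ≤ 1 - ‖p‖ ^ 2 := by nlinarith
    have : 0 ≤ 1 - ‖q‖ ^ 2 := by nlinarith
    gcongr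
  have h4 : (1 - ‖p‖ ^ 2) * (1 - ‖q‖ ^ 2) / (1 + ‖p‖ * ‖q‖) ^ 2 =
      1 - ((‖p‖ + ‖q‖) / (1 + ‖p‖ * ‖q‖)) ^ 2 := by
    have : 1 + ‖p‖ * ‖q‖ ≠ 0 := by positivity
    field_simp
    ring
  refine le_of_sq_le_sq ?_ (by positivity)
  linarith
where
  le_of_sq_le_sq {x y : ℝ} (h : x ^ 2 ≤ y ^ 2) (hy : 0 ≤ y) : x ≤ y := by nlinarith

theorem artanh_add_artanh {x y : ℝ} (hx0 : 0 ≤ x) (hx : x < 1) (hy0 : 0 ≤ y) (hy : y < 1) :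
    Real.artanh x + Real.artanh y = Real.artanh ((x + y) / (1 + x * y)) := by
  have h1 : 0 < 1 + x * y := by positivity
  have h2 : (x + y) / (1 + x * y) < 1 := by rw [div_lt_one h1]; nlinarith
  have h3 : 0 ≤ (x + y) / (1 + x * y) := by positivity
  have hx' : 0 < 1 - x := by linarith
  have hy' : 0 < 1 - y := by linarith
  rw [Real.artanh_eq_half_log ⟨by linarith, by linarith⟩,
    Real.artanh_eq_half_log ⟨by linarith, by linarith⟩,
    Real.artanh_eq_half_log ⟨by linarith, by linarith⟩, ← mul_add,
    ← Real.log_mul (by positivity) (by positivity)]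
  congr 2
  have h4 : 1 - (x + y) / (1 + x * y) = (1 - x) * (1 - y) / (1 + x * y) := by
    field_simp; ring
  rw [h4]
  field_simp
  ring

theorem tanh_le_tanh {x y : ℝ} (h : x ≤ y) : Real.tanh x ≤ Real.tanh y := by
  rwa [← Real.artanh_le_artanh_iff ⟨Real.neg_one_lt_tanh x, Real.tanh_lt_one x⟩
    ⟨Real.neg_one_lt_tanh y, Real.tanh_lt_one y⟩, Real.artanh_tanh, Real.artanh_tanh]

/-- The automorphism `moebius b` moves the middle point to `0`, and the addition formula for
`artanh` finishes. -/
theorem artanh_moebiusDist_triangle {a b c : ℂ} (ha : ‖a‖ < 1) (hb : ‖b‖ < 1) (hc : ‖c‖ < 1) :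
    Real.artanh (moebiusDist a c) ≤
      Real.artanh (moebiusDist a b) + Real.artanh (moebiusDist b c) := by
  have h1 := norm_moebius_lt_one hb ha
  have h2 := norm_moebius_lt_one hb hc
  have h := moebiusDist_le_of_norm h1 h2
  rw [moebiusDist_moebius hb ha hc, ← moebiusDist_eq_norm_moebius,
    ← moebiusDist_eq_norm_moebius, moebiusDist_comm b a] at h
  have n1 := moebiusDist_nonneg a b
  have n2 := moebiusDist_nonneg b c
  have l1 := moebiusDist_lt_one ha hb
  have l2 := moebiusDist_lt_one hb hc
  rw [artanh_add_artanh n1 l1 n2 l2]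
  refine Real.artanh_le_artanh (by linarith [moebiusDist_nonneg a c]) ?_ h
  rw [div_lt_one (by positivity)]
  nlinarith

theorem differentiableOn_moebius {a : ℂ} (ha : ‖a‖ < 1) :
    DifferentiableOn ℂ (moebius a) unitDisc := by
  unfold moebius
  refine DifferentiableOn.div (by fun_prop) (by fun_prop) fun z hz => ?_
  exact one_sub_conj_mul_ne_zero ha (mem_unitDisc.mp hz)

theorem moebiusDist_le_norm {g : ℂ → ℂ} (hg : IsHolomorphicMap g unitDisc unitDisc) {α : ℂ}
    (hα : α ∈ unitDisc) : moebiusDist (g 0) (g α) ≤ ‖α‖ := by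
  have h0 : (0 : ℂ) ∈ unitDisc := by simp [unitDisc]
  have hg0 := mem_unitDisc.mp (hg.2 h0)
  have := Complex.norm_le_norm_of_mapsTo_ball (f := fun z => moebius (g 0) (g z)) (R := 1) (z := α)
    ((differentiableOn_moebius hg0).comp hg.1 hg.2) (fun z hz => by
      simpa using (norm_moebius_lt_one hg0 (mem_unitDisc.mp (hg.2 hz))).le)
    (by simp [moebius]) (mem_unitDisc.mp hα)
  exact this

/-! ### General facts on the invariant functions -/

section Invariants

variable {E : Type*} [NormedAddCommGroup E] [NormedSpace ℂ E] {D : Set E} {z w : E}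

theorem lempert_nonneg : 0 ≤ lempert D z w := by
  apply Real.sInf_nonneg
  rintro r ⟨φ, α, -, -, -, -, rfl⟩
  exact norm_nonneg α

theorem lempert_le {φ : ℂ → E} {α : ℂ} (hφ : IsHolomorphicMap φ unitDisc D) (hα : α ∈ unitDisc)
    (h0 : φ 0 = z) (h1 : φ α = w) : lempert D z w ≤ ‖α‖ := by
  refine csInf_le ⟨0, ?_⟩ ⟨φ, α, hφ, hα, h0, h1, rfl⟩
  rintro r ⟨φ, α, -, -, -, -, rfl⟩
  exact norm_nonneg α

/-- Any two points of `D` lie on a common holomorphic disc in `D`. -/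
def DiscConnected (D : Set E) : Prop :=
  ∀ z ∈ D, ∀ w ∈ D, ∃ (φ : ℂ → E) (α : ℂ), IsHolomorphicMap φ unitDisc D ∧ α ∈ unitDisc ∧
    φ 0 = z ∧ φ α = w

theorem DiscConnected.lempert_lt_one (hD : DiscConnected D) (hz : z ∈ D) (hw : w ∈ D) :
    lempert D z w < 1 := by
  obtain ⟨φ, α, hφ, hα, h0, h1⟩ := hD z hz w hw
  exact (lempert_le hφ hα h0 h1).trans_lt (mem_unitDisc.mp hα)

/-- The infimum of the empty set of reals is `0`, so a lower bound needs at least one disc through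
both points. -/
theorem DiscConnected.le_lempert (hD : DiscConnected D) (hz : z ∈ D) (hw : w ∈ D) {c : ℝ}
    (h : ∀ (φ : ℂ → E) (α : ℂ), IsHolomorphicMap φ unitDisc D → α ∈ unitDisc → φ 0 = z →
      φ α = w → c ≤ ‖α‖) : c ≤ lempert D z w := by
  obtain ⟨φ, α, hφ, hα, h0, h1⟩ := hD z hz w hw
  refine le_csInf ⟨‖α‖, φ, α, hφ, hα, h0, h1, rfl⟩ ?_
  rintro r ⟨φ, α, hφ, hα, h0, h1, rfl⟩
  exact h φ α hφ hα h0 h1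

theorem DiscConnected.moebiusDist_le_lempert (hD : DiscConnected D) (hz : z ∈ D) (hw : w ∈ D)
    {f : E → ℂ} (hf : IsHolomorphicMap f D unitDisc) :
    moebiusDist (f z) (f w) ≤ lempert D z w := by
  refine hD.le_lempert hz hw fun φ α hφ hα h0 h1 => ?_
  subst h0 h1
  exact moebiusDist_le_norm (g := f ∘ φ) ⟨hf.1.comp hφ.1 hφ.2, hf.2.comp hφ.2⟩ hα

theorem kobayashi_le {m : ℕ} {p : ℕ → E} (h0 : p 0 = z) (hm : p m = w) (hp : ∀ j ≤ m, p j ∈ D) :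
    kobayashi D z w ≤ ∑ j ∈ Finset.range m, Real.artanh (lempert D (p j) (p (j + 1))) := by
  refine csInf_le ⟨0, ?_⟩ ⟨m, p, h0, hm, hp, rfl⟩
  rintro r ⟨m, p, -, -, -, rfl⟩
  exact Finset.sum_nonneg fun j _ => Real.artanh_nonneg lempert_nonneg

theorem kobayashi_le_artanh_lempert (hz : z ∈ D) (hw : w ∈ D) :
    kobayashi D z w ≤ Real.artanh (lempert D z w) := by
  have := kobayashi_le (D := D) (z := z) (w := w) (m := 1) (p := fun j => if j = 0 then z else w)
    (by simp) (by simp) (fun j _ => by split_ifs <;> assumption)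
  simpa using this

theorem kobayashi_le_add {v : E} (hz : z ∈ D) (hv : v ∈ D) (hw : w ∈ D) :
    kobayashi D z w ≤ Real.artanh (lempert D z v) + Real.artanh (lempert D v w) := by
  have := kobayashi_le (D := D) (z := z) (w := w) (m := 2)
    (p := fun j => if j = 0 then z else if j = 1 then v else w)
    (by simp) (by simp) (fun j _ => by split_ifs <;> assumption)
  simpa [Finset.sum_range_succ] using this

theorem DiscConnected.kobayashiStar_le_lempert (hD : DiscConnected D) (hz : z ∈ D) (hw : w ∈ D) :
    kobayashiStar D z w ≤ lempert D z w := by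
  have h1 := hD.lempert_lt_one hz hw
  have h0 := lempert_nonneg (D := D) (z := z) (w := w)
  have h := tanh_le_tanh (kobayashi_le_artanh_lempert hz hw)
  rwa [Real.tanh_artanh ⟨by linarith, h1⟩] at h

theorem DiscConnected.artanh_moebiusDist_le_kobayashi (hD : DiscConnected D) (hz : z ∈ D)
    (hw : w ∈ D) {f : E → ℂ} (hf : IsHolomorphicMap f D unitDisc) :
    Real.artanh (moebiusDist (f z) (f w)) ≤ kobayashi D z w := by
  refine le_csInf ⟨_, 1, fun j => if j = 0 then z else w, by simp, by simp,
    fun j _ => by dsimp only; split_ifs <;> assumption, rfl⟩ ?_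
  rintro r ⟨m, p, rfl, rfl, hp, rfl⟩
  have hfD : ∀ j ≤ m, ‖f (p j)‖ < 1 := fun j hj => mem_unitDisc.mp (hf.2 (hp j hj))
  have key : ∀ i ≤ m, Real.artanh (moebiusDist (f (p 0)) (f (p i))) ≤
      ∑ j ∈ Finset.range i, Real.artanh (lempert D (p j) (p (j + 1))) := by
    intro i
    induction i with
    | zero => intro _; simp [moebiusDist]
    | succ i ih =>
      intro hi
      rw [Finset.sum_range_succ]
      refine (artanh_moebiusDist_triangle (hfD 0 (by omega)) (hfD i (by omega)) (hfD _ hi)).trans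
        (add_le_add (ih (by omega)) ?_)
      refine Real.artanh_le_artanh ?_ (hD.lempert_lt_one (hp i (by omega)) (hp _ hi))
        (hD.moebiusDist_le_lempert (hp i (by omega)) (hp _ hi) hf)
      linarith [moebiusDist_nonneg (f (p i)) (f (p (i + 1)))]
  exact key m le_rfl

theorem moebiusDist_le_caratheodoryStar (hz : z ∈ D) (hw : w ∈ D) {f : E → ℂ}
    (hf : IsHolomorphicMap f D unitDisc) :
    moebiusDist (f z) (f w) ≤ caratheodoryStar D z w := by
  refine le_csSup ⟨1, ?_⟩ ⟨f, hf, rfl⟩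
  rintro r ⟨f, hf, rfl⟩
  exact (moebiusDist_lt_one (mem_unitDisc.mp (hf.2 hz)) (mem_unitDisc.mp (hf.2 hw))).le

theorem DiscConnected.caratheodoryStar_le_kobayashiStar (hD : DiscConnected D) (hz : z ∈ D)
    (hw : w ∈ D) : caratheodoryStar D z w ≤ kobayashiStar D z w := by
  refine csSup_le ⟨_, fun _ => 0, ⟨by fun_prop, fun _ _ => by simp [unitDisc]⟩, rfl⟩ ?_
  rintro r ⟨f, hf, rfl⟩
  have h := tanh_le_tanh (hD.artanh_moebiusDist_le_kobayashi hz hw hf)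
  rwa [Real.tanh_artanh ⟨by linarith [moebiusDist_nonneg (f z) (f w)],
    moebiusDist_lt_one (mem_unitDisc.mp (hf.2 hz)) (mem_unitDisc.mp (hf.2 hw))⟩] at h

end Invariants


/-! ### The symmetrization map -/

-- The generating polynomial `∏ (1 + z_i X)` carries all the computations with `σ`: its coefficients
-- are the coordinates of `σ(z)`.
open Polynomial in
theorem prod_one_add_C_mul_X (n : ℕ) (z : Fin n → ℂ) :
    ∏ i, (1 + C (z i) * X) = 1 + ∑ k : Fin n, C (symMap n z k) * X ^ ((k : ℕ) + 1) := by
  rw [Finset.prod_one_add, Finset.sum_powerset, Finset.card_univ, Fintype.card_fin,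
    Finset.sum_range_succ', Finset.sum_range, add_comm]
  congr 1
  · simp
  · refine Finset.sum_congr rfl fun k _ => ?_
    rw [symMap, map_sum, Finset.sum_mul]
    refine Finset.sum_congr rfl fun s hs => ?_
    rw [Finset.prod_mul_distrib, Finset.prod_const, (Finset.mem_powersetCard.mp hs).2, map_prod]

theorem prod_one_add_mul (n : ℕ) (z : Fin n → ℂ) (t : ℂ) :
    ∏ i, (1 + z i * t) = 1 + ∑ k : Fin n, symMap n z k * t ^ ((k : ℕ) + 1) := by
  simpa [Polynomial.eval_prod, Polynomial.eval_finsetSum] using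
    congrArg (Polynomial.eval t) (prod_one_add_C_mul_X n z)

open Polynomial in
/-- Equality in the symmetrization map is detected by the generating polynomial. -/
theorem symMap_eq_of_prod {n : ℕ} {z w : Fin n → ℂ}
    (h : ∀ t : ℂ, ∏ i, (1 + z i * t) = 1 + ∑ k : Fin n, w k * t ^ ((k : ℕ) + 1)) :
    symMap n z = w := by
  have hp : (1 + ∑ k : Fin n, C (symMap n z k) * X ^ ((k : ℕ) + 1) : ℂ[X]) =
      1 + ∑ k : Fin n, C (w k) * X ^ ((k : ℕ) + 1) := by
    refine Polynomial.funext fun t => ?_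
    simpa [Polynomial.eval_finsetSum] using (prod_one_add_mul n z t).symm.trans (h t)
  have hc : ∀ (v : Fin n → ℂ) (k : Fin n),
      (∑ k : Fin n, C (v k) * X ^ ((k : ℕ) + 1) : ℂ[X]).coeff ((k : ℕ) + 1) = v k := by
    intro v k
    rw [Polynomial.finsetSum_coeff, Finset.sum_eq_single k]
    · simp
    · intro j _ hj
      have : (k : ℕ) ≠ j := fun h => hj (Fin.ext h.symm)
      simp [Polynomial.coeff_X_pow, this]
    · simp
  funext k
  rw [← hc (symMap n z) k, add_left_cancel hp, hc]

theorem differentiable_symMap (n : ℕ) : Differentiable ℂ (symMap n) := by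
  unfold symMap
  fun_prop

theorem symMap_zero (n : ℕ) : symMap n 0 = 0 :=
  symMap_eq_of_prod fun t => by simp

theorem zero_mem_symPolydisc (n : ℕ) : (0 : Fin n → ℂ) ∈ symPolydisc n :=
  ⟨0, fun _ => by simp [unitDisc], symMap_zero n⟩

/-- By the fundamental theorem on symmetric polynomials, power sums of the roots are polynomials in
the coordinates of `σ`, so they can serve as test functions on `G_n`. -/
theorem exists_powerSum (n m : ℕ) :
    ∃ P : (Fin n → ℂ) → ℂ, Differentiable ℂ P ∧ ∀ z, P (symMap n z) = ∑ i, z i ^ m := by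
  obtain ⟨q, hq⟩ := MvPolynomial.esymmAlgHom_surjective (σ := Fin n) (n := n) ℂ (by simp)
    ⟨MvPolynomial.psum (Fin n) ℂ m, MvPolynomial.psum_isSymmetric (Fin n) ℂ m⟩
  refine ⟨fun w => MvPolynomial.eval w q, fun w => ?_, fun z => ?_⟩
  · exact (AnalyticOnNhd.eval_mvPolynomial q w trivial).differentiableAt
  · have h : MvPolynomial.aeval (symMap n z) = ((MvPolynomial.aeval z).comp
        (MvPolynomial.symmetricSubalgebra (Fin n) ℂ).val).comp
          (MvPolynomial.esymmAlgHom (Fin n) ℂ n) := by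
      refine MvPolynomial.algHom_ext fun k => ?_
      simp [MvPolynomial.esymmAlgHom, MvPolynomial.esymm, symMap]
    have h1 := DFunLike.congr_fun h q
    simpa [hq, MvPolynomial.psum, MvPolynomial.aeval_def, MvPolynomial.eval₂_id] using h1

theorem norm_pow_le_sum_norm_symMap {n : ℕ} (z : Fin n → ℂ) (i : Fin n) (hz : ‖z i‖ ≤ 1) :
    ‖z i‖ ^ n ≤ ∑ k, ‖symMap n z k‖ := by
  have hn : n ≠ 0 := fun h => by subst h; exact i.elim0
  by_cases h0 : z i = 0
  · rw [h0, norm_zero, zero_pow hn]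
    exact Finset.sum_nonneg fun k _ => norm_nonneg _
  -- At `t = -1/z_i` the generating polynomial vanishes; multiplying by `z_i ^ n` expresses `z_i ^
  -- n` through the coordinates of `σ(z)`.
  have h := prod_one_add_mul n z (-(z i)⁻¹)
  rw [Finset.prod_eq_zero (Finset.mem_univ i) (by field_simp; ring)] at h
  have h2 : z i ^ n = -∑ k : Fin n, symMap n z k * ((-1) ^ ((k : ℕ) + 1) *
      z i ^ (n - ((k : ℕ) + 1))) := by
    have e : ∀ k : Fin n, symMap n z k * ((-1) ^ ((k : ℕ) + 1) * z i ^ (n - ((k : ℕ) + 1))) =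
        z i ^ n * (symMap n z k * (-(z i)⁻¹) ^ ((k : ℕ) + 1)) := by
      intro k
      have : z i ^ n = z i ^ (n - ((k : ℕ) + 1)) * z i ^ ((k : ℕ) + 1) := by
        rw [← pow_add]; congr 1; omega
      rw [this, neg_pow (z i)⁻¹, inv_pow]
      field_simp
    rw [Finset.sum_congr rfl fun k _ => e k, ← Finset.mul_sum]
    linear_combination (-z i ^ n) * h
  rw [← norm_pow, h2, norm_neg]
  refine (norm_sum_le _ _).trans (Finset.sum_le_sum fun k _ => ?_)
  rw [norm_mul, norm_mul, norm_pow, norm_neg, norm_one, one_pow, one_mul, norm_pow]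
  exact mul_le_of_le_one_right (norm_nonneg _) (pow_le_one₀ (norm_nonneg _) hz)

theorem discConnected_symPolydisc (n : ℕ) : DiscConnected (symPolydisc n) := by
  rintro _ ⟨a, ha, rfl⟩ _ ⟨b, hb, rfl⟩
  simp only [Set.mem_ofPred_eq, mem_unitDisc] at ha hb
  -- A common parameter for all coordinates: division by `r` keeps each disc `ζ ↦ ζ * moebius (a i)
  -- (b i) / r` inside the unit disc, and `ζ = r` reaches every target at once.
  obtain ⟨r, hr0, hr1, hr⟩ : ∃ r : ℝ, 0 < r ∧ r < 1 ∧ ∀ i, ‖moebius (a i) (b i)‖ ≤ r := by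
    have hlt : ∀ i, ‖moebius (a i) (b i)‖ < 1 := fun i => norm_moebius_lt_one (ha i) (hb i)
    have : ∀ᶠ r in nhdsWithin (1 : ℝ) (Set.Iio 1),
        0 < r ∧ r < 1 ∧ ∀ i, ‖moebius (a i) (b i)‖ ≤ r := by
      refine Filter.Eventually.and ?_ (Filter.Eventually.and ?_ (Filter.eventually_all.mpr ?_))
      · exact (lt_mem_nhds one_pos).filter_mono nhdsWithin_le_nhds
      · exact self_mem_nhdsWithin
      · intro i
        exact ((lt_mem_nhds (hlt i)).filter_mono nhdsWithin_le_nhds).mono fun _ h => h.le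
    exact this.exists
  have hrC : (r : ℂ) ≠ 0 := by exact_mod_cast hr0.ne'
  have hmaps : ∀ i, Set.MapsTo (fun ζ : ℂ => ζ * (moebius (a i) (b i) / r)) unitDisc unitDisc := by
    intro i ζ hζ
    rw [mem_unitDisc] at hζ ⊢
    rw [norm_mul, norm_div, Complex.norm_real, Real.norm_of_nonneg hr0.le]
    have : ‖moebius (a i) (b i)‖ / r ≤ 1 := (div_le_one hr0).mpr (hr i)
    exact (mul_le_of_le_one_right (norm_nonneg _) this).trans_lt hζ
  refine ⟨fun ζ => symMap n fun i => moebius (a i) (ζ * (moebius (a i) (b i) / r)), r,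
    ⟨?_, fun ζ hζ => ⟨_, fun i => ?_, rfl⟩⟩, ?_, ?_, ?_⟩
  · refine (differentiable_symMap n).comp_differentiableOn (differentiableOn_pi.mpr fun i => ?_)
    exact (differentiableOn_moebius (ha i)).comp (by fun_prop) (hmaps i)
  · exact mem_unitDisc.mpr (norm_moebius_lt_one (ha i) (mem_unitDisc.mp (hmaps i hζ)))
  · rw [mem_unitDisc, Complex.norm_real, Real.norm_of_nonneg hr0.le]; exact hr1
  · simp [moebius]
  · dsimp only
    congr 1
    funext i
    rw [mul_div_cancel₀ _ hrC, moebius_moebius (ha i) (hb i)]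

/-! ### The functions `f_λ` -/

section TestFun

variable {n : ℕ} (l : ℂ)

theorem testFun_numerator {z : Fin n → ℂ} {p : Polynomial ℂ}
    (hp : ∀ t : ℂ, ∏ i, (1 + z i * t) = p.eval t) :
    ∑ k : Fin n, ((k : ℂ) + 1) * symMap n z k * l ^ (k : ℕ) = p.derivative.eval l := by
  have h : p = 1 + ∑ k : Fin n, Polynomial.C (symMap n z k) * Polynomial.X ^ ((k : ℕ) + 1) := by
    refine Polynomial.funext fun t => ?_
    rw [← hp, prod_one_add_mul]
    simp [Polynomial.eval_finsetSum]
  rw [h]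
  simp only [Polynomial.derivative_add, Polynomial.derivative_one, Polynomial.derivative_sum,
    Polynomial.derivative_C_mul_X_pow, Polynomial.eval_finsetSum, zero_add]
  simp [mul_comm]

theorem testFun_denominator {z : Fin n → ℂ} {p : Polynomial ℂ}
    (hp : ∀ t : ℂ, ∏ i, (1 + z i * t) = p.eval t) :
    n + ∑ k : Fin n, ((n : ℂ) - ((k : ℂ) + 1)) * symMap n z k * l ^ ((k : ℕ) + 1) =
      n * p.eval l - l * p.derivative.eval l := by
  rw [← testFun_numerator l hp, ← hp, prod_one_add_mul, mul_add, mul_one, Finset.mul_sum,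
    Finset.mul_sum, add_sub_assoc, ← Finset.sum_sub_distrib]
  congr 1
  exact Finset.sum_congr rfl fun k _ => by ring

theorem testFun_symMap {z : Fin n → ℂ} {p : Polynomial ℂ}
    (hp : ∀ t : ℂ, ∏ i, (1 + z i * t) = p.eval t) :
    testFun n l (symMap n z) =
      p.derivative.eval l / (n * p.eval l - l * p.derivative.eval l) := by
  rw [testFun, testFun_numerator l hp, testFun_denominator l hp]

theorem re_div_one_add_lt {u : ℂ} (hu : ‖u‖ < 1) : (u / (1 + u)).re < 1 / 2 := by
  have h0 : 1 + u ≠ 0 := by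
    intro h
    have : u = -1 := by linear_combination h
    simp [this] at hu
  have h1 : 0 < Complex.normSq (1 + u) := Complex.normSq_pos.mpr h0
  have h2 : Complex.normSq u < 1 := by
    rw [Complex.normSq_eq_norm_sq]; nlinarith [norm_nonneg u]
  rw [Complex.div_re, ← add_div, div_lt_iff₀ h1]
  simp only [Complex.normSq_apply, Complex.add_re, Complex.add_im, Complex.one_re,
    Complex.one_im] at *
  nlinarith

/-- With `U = λ p'/p = ∑ λ z_i / (1 + λ z_i)`, the modulus of `f_λ` is `|U| / |n - U|`. It is below
`1` because each summand has real part below `1/2`, so `U` is closer to `0` than to `n`. -/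
theorem testFun_mem_unitDisc (hn : n ≠ 0) (hl : ‖l‖ = 1) {w : Fin n → ℂ} (hw : w ∈ symPolydisc n) :
    ((n : ℂ) + ∑ k : Fin n, ((n : ℂ) - ((k : ℂ) + 1)) * w k * l ^ ((k : ℕ) + 1)) ≠ 0 ∧
      testFun n l w ∈ unitDisc := by
  obtain ⟨z, hz, rfl⟩ := hw
  simp only [Set.mem_ofPred_eq, mem_unitDisc] at hz
  set p : Polynomial ℂ := ∏ i, (1 + Polynomial.C (z i) * Polynomial.X) with hpdef
  have hp : ∀ t : ℂ, ∏ i, (1 + z i * t) = p.eval t := fun t => by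
    simp [hpdef, Polynomial.eval_prod]
  have hz1 : ∀ i, ‖l * z i‖ < 1 := fun i => by simpa [hl] using hz i
  have hne : ∀ i, 1 + z i * l ≠ 0 := by
    intro i h
    have h1 : l * z i = -1 := by linear_combination h
    have h2 := hz1 i
    simp [h1] at h2
  have hp0 : p.eval l ≠ 0 := by
    rw [← hp]
    exact Finset.prod_ne_zero_iff.mpr fun i _ => hne i
  set U : ℂ := ∑ i, l * z i / (1 + l * z i) with hU
  have hd : l * p.derivative.eval l = p.eval l * U := by
    rw [hpdef, Polynomial.derivative_prod_finset, Polynomial.eval_finsetSum, hU, Finset.mul_sum,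
      Finset.mul_sum]
    refine Finset.sum_congr rfl fun i _ => ?_
    have h1 : 1 + l * z i ≠ 0 := by rw [mul_comm l]; exact hne i
    rw [← Finset.mul_prod_erase _ _ (Finset.mem_univ i)]
    simp [Polynomial.eval_mul]
    field_simp
  have hUre : U.re < n / 2 := by
    rw [hU, Complex.re_sum]
    refine (Finset.sum_lt_sum_of_nonempty ?_
      fun i _ => re_div_one_add_lt (hz1 i)).trans_eq ?_
    · exact Finset.univ_nonempty_iff.mpr ⟨⟨0, Nat.pos_of_ne_zero hn⟩⟩
    · simp; ring
  have hn0 : (0 : ℝ) < n := by exact_mod_cast Nat.pos_of_ne_zero hn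
  have hlt : ‖U‖ < ‖(n : ℂ) - U‖ := by
    refine lt_of_pow_lt_pow_left₀ 2 (norm_nonneg _) ?_
    simp only [Complex.sq_norm, Complex.normSq_apply, Complex.sub_re, Complex.sub_im,
      Complex.natCast_re, Complex.natCast_im]
    nlinarith
  have hnU : ‖(n : ℂ) - U‖ ≠ 0 := ((norm_nonneg _).trans_lt hlt).ne'
  have hden : (n : ℂ) * p.eval l - l * p.derivative.eval l = p.eval l * (n - U) := by
    rw [hd]; ring
  refine ⟨?_, ?_⟩
  · rw [testFun_denominator l hp, hden]
    exact mul_ne_zero hp0 (norm_ne_zero_iff.mp hnU)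
  · have h1 : ‖p.derivative.eval l‖ = ‖p.eval l‖ * ‖U‖ := by
      rw [← norm_mul, ← hd, norm_mul, hl, one_mul]
    rw [mem_unitDisc, testFun_symMap l hp, hden, norm_div, h1, norm_mul,
      mul_div_mul_left _ _ (norm_ne_zero_iff.mpr hp0), div_lt_one ((norm_nonneg _).trans_lt hlt)]
    exact hlt

theorem isHolomorphicMap_testFun (hn : n ≠ 0) (hl : ‖l‖ = 1) :
    IsHolomorphicMap (testFun n l) (symPolydisc n) unitDisc := by
  refine ⟨?_, fun w hw => (testFun_mem_unitDisc l hn hl hw).2⟩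
  unfold testFun
  simp only [div_eq_mul_inv]
  refine DifferentiableOn.mul (Differentiable.differentiableOn (by fun_prop))
    (DifferentiableOn.inv (Differentiable.differentiableOn (by fun_prop)) ?_)
  exact fun w hw => (testFun_mem_unitDisc l hn hl hw).1

theorem testFun_zero : testFun n l 0 = 0 := by simp [testFun]

theorem mDist_le_caratheodoryStar (hn : n ≠ 0) {z w : Fin n → ℂ} (hz : z ∈ symPolydisc n)
    (hw : w ∈ symPolydisc n) : mDist n z w ≤ caratheodoryStar (symPolydisc n) z w := by
  have : Nonempty (Metric.sphere (0 : ℂ) 1) := ⟨⟨1, by simp⟩⟩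
  refine ciSup_le fun l => moebiusDist_le_caratheodoryStar hz hw
    (isHolomorphicMap_testFun l hn (by simp))

end TestFun


/-! ### Roots of unity -/

section RootsOfUnity

variable {n : ℕ} {ω : ℂ}

theorem prod_sub_rootsOfUnity_mul (hn : n ≠ 0) (hω : IsPrimitiveRoot ω n) (x y : ℂ) :
    ∏ i : Fin n, (x - ω ^ (i : ℕ) * y) = x ^ n - y ^ n := by
  classical
  have hinj : Function.Injective fun i : Fin n => ω ^ (i : ℕ) :=
    fun i j h => Fin.ext (hω.pow_inj i.2 j.2 h)
  have himg : Finset.univ.image (fun i : Fin n => ω ^ (i : ℕ)) =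
      Polynomial.nthRootsFinset n (1 : ℂ) := by
    refine Finset.eq_of_subset_of_card_le (fun x hx => ?_) ?_
    · obtain ⟨i, -, rfl⟩ := Finset.mem_image.mp hx
      rw [Polynomial.mem_nthRootsFinset (Nat.pos_of_ne_zero hn), ← pow_mul, mul_comm, pow_mul,
        hω.pow_eq_one, one_pow]
    · rw [hω.card_nthRootsFinset, Finset.card_image_of_injective _ hinj, Finset.card_univ,
        Fintype.card_fin]
  rw [hω.pow_sub_pow_eq_prod_sub_mul x y (Nat.pos_of_ne_zero hn), ← himg,
    Finset.prod_image fun i _ j _ h => hinj h]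

theorem sum_rootsOfUnity_pow (hω : IsPrimitiveRoot ω n) (m : ℕ) :
    ∑ i : Fin n, (ω ^ (i : ℕ)) ^ m = if n ∣ m then (n : ℂ) else 0 := by
  have h : ∀ i : ℕ, (ω ^ i) ^ m = (ω ^ m) ^ i := fun i => by
    rw [← pow_mul, mul_comm, pow_mul]
  rw [Fin.sum_univ_eq_sum_range (fun i => (ω ^ i) ^ m)]
  split_ifs with hm
  · simp [h, (hω.pow_eq_one_iff_dvd m).mpr hm]
  · have h1 : ω ^ m ≠ 1 := fun h1 => hm ((hω.pow_eq_one_iff_dvd m).mp h1)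
    rw [Finset.sum_congr rfl fun i _ => h i, geom_sum_eq h1, ← pow_mul, mul_comm, pow_mul,
      hω.pow_eq_one, one_pow, sub_self, zero_div]

end RootsOfUnity

/-! ### A lower bound for the Lempert function at the origin -/

theorem norm_powerSum_le {n : ℕ} {z : Fin n → ℂ} (hz : ∀ i, ‖z i‖ ≤ 1) (m : ℕ) :
    ‖∑ i, z i ^ m‖ ≤ n := by
  refine (norm_sum_le_of_le (f := fun i => z i ^ m) _ (n := fun _ => (1 : ℝ))
    fun i _ => ?_).trans_eq (by simp)
  rw [norm_pow]
  exact pow_le_one₀ (norm_nonneg _) (hz i)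

/-- A higher-order Schwarz lemma. The roots of `φ ζ` are `O(|ζ|^(1/n))`, so the power sum of degree
`n m + 1` is `o(|ζ|^m)`; being holomorphic in `ζ`, it vanishes to order `m + 1`. -/
theorem norm_powerSum_le_of_disc {n : ℕ} (hn : n ≠ 0) (m : ℕ) {φ : ℂ → Fin n → ℂ} {α : ℂ}
    {z : Fin n → ℂ} (hφ : IsHolomorphicMap φ unitDisc (symPolydisc n)) (h0 : φ 0 = 0)
    (hα : α ∈ unitDisc) (h1 : φ α = symMap n z) :
    ‖∑ i, z i ^ (n * m + 1)‖ ≤ n * ‖α‖ ^ (m + 1) := by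
  obtain ⟨P, hPd, hP⟩ := exists_powerSum n (n * m + 1)
  have hP0 : P 0 = 0 := by rw [← symMap_zero, hP]; simp
  have hbound : ∀ ζ ∈ unitDisc, ‖P (φ ζ)‖ ≤ n ∧
      ‖P (φ ζ)‖ ≤ n * ((n * ‖φ ζ‖) ^ m * (n * ‖φ ζ‖) ^ ((n : ℝ)⁻¹)) := by
    intro ζ hζ
    obtain ⟨x, hx, hxφ⟩ := hφ.2 hζ
    have hx1 : ∀ i, ‖x i‖ ≤ 1 := fun i => (mem_unitDisc.mp (hx i)).le
    rw [← hxφ, hP]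
    refine ⟨norm_powerSum_le hx1 _, ?_⟩
    have hxn : ∀ i, ‖x i‖ ^ n ≤ n * ‖symMap n x‖ := by
      intro i
      refine (norm_pow_le_sum_norm_symMap x i (hx1 i)).trans ?_
      refine (Finset.sum_le_card_nsmul _ _ ‖symMap n x‖ fun k _ => norm_le_pi_norm _ k).trans_eq ?_
      simp
    refine (norm_sum_le_of_le _ (n := fun _ => (n * ‖symMap n x‖) ^ m *
      (n * ‖symMap n x‖) ^ ((n : ℝ)⁻¹)) fun i _ => ?_).trans_eq (by simp)
    rw [norm_pow, pow_succ, pow_mul]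
    refine mul_le_mul (pow_le_pow_left₀ (by positivity) (hxn i) m) ?_ (norm_nonneg _)
      (by positivity)
    have := Real.rpow_le_rpow (by positivity) (hxn i) (z := (n : ℝ)⁻¹) (by positivity)
    rwa [Real.pow_rpow_inv_natCast (norm_nonneg _) hn] at this
  have hmem : unitDisc ∈ nhds (0 : ℂ) := Metric.ball_mem_nhds 0 one_pos
  have hφd : DifferentiableAt ℂ φ 0 := hφ.1.differentiableAt hmem
  have hO : (fun ζ => n * ‖φ ζ‖) =O[nhds 0] fun ζ : ℂ => ‖ζ‖ := by
    have := hφd.isBigO_sub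
    simp only [h0, sub_zero] at this
    exact (this.norm_norm).const_mul_left _
  have ho : (fun ζ => (n * ‖φ ζ‖) ^ ((n : ℝ)⁻¹)) =o[nhds 0] fun _ : ℂ => (1 : ℝ) := by
    rw [Asymptotics.isLittleO_one_iff]
    have hc : Filter.Tendsto (fun ζ => (n : ℝ) * ‖φ ζ‖) (nhds 0) (nhds 0) := by
      simpa [h0] using (hφd.continuousAt.norm.const_mul (n : ℝ)).tendsto
    have := hc.rpow_const (p := (n : ℝ)⁻¹) (Or.inr (by positivity))
    rwa [Real.zero_rpow (by positivity)] at this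
  have hlo : (fun ζ => P (φ ζ) - P (φ 0)) =o[nhds 0] fun ζ : ℂ => ‖ζ - 0‖ ^ m := by
    have h2 := ((hO.pow m).mul_isLittleO ho).const_mul_left (n : ℝ)
    simp only [mul_one] at h2
    simp only [h0, hP0, sub_zero]
    refine Asymptotics.IsBigO.trans_isLittleO ?_ h2
    refine Asymptotics.IsBigO.of_bound' ?_
    filter_upwards [hmem] with ζ hζ
    exact (hbound ζ hζ).2.trans (le_abs_self _)
  have := Complex.dist_le_mul_div_pow_of_mapsTo_ball_of_isLittleO (f := fun ζ => P (φ ζ))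
    (R₁ := 1) (R₂ := n) (hPd.comp_differentiableOn hφ.1)
    (fun ζ hζ => by simpa [h0, hP0] using (hbound ζ hζ).1) hlo hα
  simpa [h0, hP0, h1, hP] using this

/-! ### Chains through the diagonal -/

section Chain

variable {n : ℕ} {s : ℝ} {ω : ℂ}

/-- The generating polynomial is `(1 + s t)^n - (-(1 - s) η t)^n`: only the top coefficient depends
on `η`, and it does so through `η ^ n`. -/
theorem symMap_translate_roots (hn : n ≠ 0) (hω : IsPrimitiveRoot ω n) (s : ℝ) {η ζ : ℂ}
    (h : η ^ n = ζ) :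
    symMap n (fun i => s + (1 - s) * (ω ^ (i : ℕ) * η)) = fun k => symMap n (fun _ => (s : ℂ)) k +
      ζ * if (k : ℕ) + 1 = n then -(-(1 - s : ℂ)) ^ n else 0 := by
  refine symMap_eq_of_prod fun t => ?_
  have h1 := prod_sub_rootsOfUnity_mul hn hω (1 + s * t) (-((1 - s) * η * t))
  have h2 := prod_one_add_mul n (fun _ => (s : ℂ)) t
  have h3 : ∑ k : Fin n, (ζ * if (k : ℕ) + 1 = n then -(-(1 - s : ℂ)) ^ n else 0) *
      t ^ ((k : ℕ) + 1) = -(-(1 - s : ℂ)) ^ n * ζ * t ^ n := by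
    obtain ⟨N, rfl⟩ := Nat.exists_eq_succ_of_ne_zero hn
    rw [Finset.sum_eq_single (Fin.last N)]
    · simp [mul_comm ζ]
    · intro k _ hk
      have : (k : ℕ) ≠ N := fun h => hk (Fin.ext h)
      simp [this]
    · simp
  simp only [add_mul, Finset.sum_add_distrib] at h3 ⊢
  rw [h3, ← add_assoc, ← h2, Finset.prod_const, Finset.card_univ, Fintype.card_fin]
  calc _ = ∏ i : Fin n, (1 + s * t - ω ^ (i : ℕ) * (-((1 - s) * η * t))) :=
        Finset.prod_congr rfl fun i _ => by ring
    _ = _ := by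
        rw [h1, ← h, show -((1 - s) * η * t) = -(1 - s : ℂ) * η * t by ring, mul_pow, mul_pow]
        ring

theorem norm_translate_lt_one (hs0 : 0 ≤ s) (hs1 : s < 1) {η : ℂ} (hη : ‖η‖ < 1) :
    ‖(s : ℂ) + (1 - s) * η‖ < 1 := by
  have h1 : ‖(1 : ℂ) - s‖ = 1 - s := by
    rw [← Complex.ofReal_one, ← Complex.ofReal_sub, Complex.norm_real,
      Real.norm_of_nonneg (by linarith)]
  refine (norm_add_le _ _).trans_lt ?_
  rw [norm_mul, h1, Complex.norm_real, Real.norm_of_nonneg hs0]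
  nlinarith

theorem norm_root_mul_lt_one (hn : n ≠ 0) (hω : IsPrimitiveRoot ω n) {η : ℂ} (hη : ‖η‖ < 1)
    (i : ℕ) : ‖ω ^ i * η‖ < 1 := by
  rw [norm_mul, norm_pow, hω.norm'_eq_one hn, one_pow, one_mul]
  exact hη

theorem lempert_zero_diagonal_le (hs0 : 0 ≤ s) (hs1 : s < 1) :
    lempert (symPolydisc n) 0 (symMap n fun _ => (s : ℂ)) ≤ s := by
  have hs : ‖(s : ℂ)‖ = s := by rw [Complex.norm_real, Real.norm_of_nonneg hs0]
  have := lempert_le (D := symPolydisc n) (φ := fun ζ => symMap n fun _ => ζ) (α := s)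
    ⟨((differentiable_symMap n).comp (by fun_prop)).differentiableOn,
      fun ζ hζ => ⟨_, fun _ => hζ, rfl⟩⟩ (by rw [mem_unitDisc, hs]; exact hs1)
    (symMap_zero n) rfl
  rwa [hs] at this

/-- The disc is affine with parameter `ζ = η ^ n`. It stays in `G_n` because every `ζ` in the disc
has an `n`-th root there, and `s + (1 - s) 𝔻 ⊆ 𝔻`. -/
theorem lempert_diagonal_translate_le (hn : n ≠ 0) (hω : IsPrimitiveRoot ω n) (hs0 : 0 ≤ s)
    (hs1 : s < 1) {η : ℂ} (hη : ‖η‖ < 1) :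
    lempert (symPolydisc n) (symMap n fun _ => (s : ℂ))
      (symMap n fun i => s + (1 - s) * (ω ^ (i : ℕ) * η)) ≤ ‖η‖ ^ n := by
  rw [← norm_pow]
  refine lempert_le (φ := fun ζ k => symMap n (fun _ => (s : ℂ)) k +
      ζ * if (k : ℕ) + 1 = n then -(-(1 - s : ℂ)) ^ n else 0)
    ⟨Differentiable.differentiableOn (by fun_prop), fun ζ hζ => ?_⟩ ?_ (by simp)
    (symMap_translate_roots hn hω s rfl).symm
  · obtain ⟨ξ, hξ⟩ := IsAlgClosed.exists_pow_nat_eq ζ (Nat.pos_of_ne_zero hn)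
    have hξ1 : ‖ξ‖ < 1 := by
      rw [mem_unitDisc, ← hξ, norm_pow] at hζ
      exact (pow_lt_one_iff_of_nonneg (norm_nonneg _) hn).mp hζ
    exact ⟨_, fun i => mem_unitDisc.mpr
      (norm_translate_lt_one hs0 hs1 (norm_root_mul_lt_one hn hω hξ1 i)),
      symMap_translate_roots hn hω s hξ⟩
  · rw [mem_unitDisc, norm_pow]
    exact pow_lt_one₀ (norm_nonneg _) hη hn

theorem le_norm_powerSum_translate (hω : IsPrimitiveRoot ω n) (hs0 : 0 ≤ s) (hs1 : s ≤ 1) {r : ℝ}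
    (hr : 0 ≤ r) :
    n * ((2 * n + 1) * s * ((1 - s) ^ n * r ^ n) ^ 2) ≤
      ‖∑ i : Fin n, ((s : ℂ) + (1 - s) * (ω ^ (i : ℕ) * r)) ^ (n * 2 + 1)‖ := by
  have h1 : 0 ≤ 1 - s := by linarith
  have h : ∑ i : Fin n, ((s : ℂ) + (1 - s) * (ω ^ (i : ℕ) * r)) ^ (n * 2 + 1) =
      ((∑ m ∈ Finset.range (n * 2 + 1 + 1), s ^ m * ((1 - s) * r) ^ (n * 2 + 1 - m) *
        (n * 2 + 1).choose m * (if n ∣ n * 2 + 1 - m then (n : ℝ) else 0) : ℝ) : ℂ) := by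
    simp only [add_pow]
    rw [Finset.sum_comm, Complex.ofReal_sum]
    refine Finset.sum_congr rfl fun m _ => ?_
    have h2 := sum_rootsOfUnity_pow hω (n * 2 + 1 - m)
    have h3 : ∀ i : Fin n, (s : ℂ) ^ m * ((1 - s) * (ω ^ (i : ℕ) * r)) ^ (n * 2 + 1 - m) *
        (n * 2 + 1).choose m = s ^ m * ((1 - s) * r) ^ (n * 2 + 1 - m) *
          (n * 2 + 1).choose m * (ω ^ (i : ℕ)) ^ (n * 2 + 1 - m) := fun i => by
      rw [mul_pow, mul_pow, mul_pow]; ring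
    rw [Finset.sum_congr rfl fun i _ => h3 i, ← Finset.mul_sum, h2]
    split_ifs <;> simp
  have hnn : ∀ m ∈ Finset.range (n * 2 + 1 + 1), 0 ≤ s ^ m * ((1 - s) * r) ^ (n * 2 + 1 - m) *
        (n * 2 + 1).choose m * (if n ∣ n * 2 + 1 - m then (n : ℝ) else 0) := fun m _ => by
    have : (0 : ℝ) ≤ if n ∣ n * 2 + 1 - m then (n : ℝ) else 0 := by split_ifs <;> positivity
    positivity
  rw [h, Complex.norm_real, Real.norm_of_nonneg (Finset.sum_nonneg hnn)]
  -- In the binomial expansion, summing over the roots of unity leaves only nonnegative terms; the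
  -- one with a single factor `s` is kept.
  refine le_trans (le_of_eq ?_) (Finset.single_le_sum hnn (a := 1) (by simp))
  simp only [pow_one, Nat.add_sub_cancel, Nat.choose_one_right, dvd_mul_right, if_true, mul_pow,
    pow_mul]
  push_cast
  ring

theorem exists_kobayashiStar_lt_lempert (hn : 3 ≤ n) :
    ∃ w ∈ symPolydisc n, kobayashiStar (symPolydisc n) 0 w < lempert (symPolydisc n) 0 w := by
  have hn0 : n ≠ 0 := by omega
  have hn3 : (3 : ℝ) ≤ n := by exact_mod_cast hn
  -- At `t = 0` the right side is `4 (2n + 1) ≥ 28`; this is where `n ≥ 3` enters. The `27` comes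
  -- from `s r^(2n) = (t/3) (2t/3)^2`.
  obtain ⟨t, ht0, ht1, ht⟩ : ∃ t : ℝ, 0 < t ∧ t < 1 ∧
      27 < 4 * (2 * n + 1) * ((1 - t / 3) ^ n) ^ 2 := by
    have hc : Filter.Tendsto (fun t : ℝ => 4 * (2 * n + 1) * ((1 - t / 3) ^ n) ^ 2)
        (nhdsWithin 0 (Set.Ioi 0)) (nhds (4 * (2 * n + 1) * ((1 - (0 : ℝ) / 3) ^ n) ^ 2)) := by
      refine (ContinuousAt.tendsto (x := 0) ?_).mono_left nhdsWithin_le_nhds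
      fun_prop
    have h1 := hc.eventually (lt_mem_nhds (a := (27 : ℝ)) (by norm_num; linarith))
    have h2 : ∀ᶠ t : ℝ in nhdsWithin 0 (Set.Ioi 0), t < 1 :=
      (gt_mem_nhds one_pos).filter_mono nhdsWithin_le_nhds
    have h3 : ∀ᶠ t : ℝ in nhdsWithin 0 (Set.Ioi 0), 0 < t := self_mem_nhdsWithin
    exact (h3.and (h2.and h1)).exists
  obtain ⟨r, hr0, hr⟩ : ∃ r : ℝ, 0 ≤ r ∧ r ^ n = 2 * t / 3 :=
    ⟨(2 * t / 3) ^ ((n : ℝ)⁻¹), by positivity, Real.rpow_inv_natCast_pow (by positivity) hn0⟩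
  have hr1 : ‖(r : ℂ)‖ < 1 := by
    rw [Complex.norm_real, Real.norm_of_nonneg hr0]
    exact (pow_lt_one_iff_of_nonneg hr0 hn0).mp (by rw [hr]; linarith)
  set s : ℝ := t / 3 with hs
  have hs0 : 0 < s := by positivity
  have hs1 : s < 1 := by rw [hs]; linarith
  have hω := Complex.isPrimitiveRoot_exp n hn0
  set ω := Complex.exp (2 * Real.pi * Complex.I / n)
  have hD := discConnected_symPolydisc n
  have hzero := zero_mem_symPolydisc n
  have hp : symMap n (fun _ => (s : ℂ)) ∈ symPolydisc n := ⟨_, fun _ => mem_unitDisc.mpr (by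
    rw [Complex.norm_real, Real.norm_of_nonneg hs0.le]; exact hs1), rfl⟩
  have hw : symMap n (fun i => s + (1 - s) * (ω ^ (i : ℕ) * r)) ∈ symPolydisc n :=
    ⟨_, fun i => mem_unitDisc.mpr
      (norm_translate_lt_one hs0.le hs1 (norm_root_mul_lt_one hn0 hω hr1 i)), rfl⟩
  refine ⟨_, hw, ?_⟩
  have hl1 := lempert_zero_diagonal_le (n := n) hs0.le hs1
  have hl2 := lempert_diagonal_translate_le hn0 hω hs0.le hs1 hr1
  rw [Complex.norm_real, Real.norm_of_nonneg hr0, hr] at hl2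
  have hk : kobayashiStar (symPolydisc n) 0
      (symMap n fun i => s + (1 - s) * (ω ^ (i : ℕ) * r)) ≤
        (s + 2 * t / 3) / (1 + s * (2 * t / 3)) := by
    have ha : 0 ≤ 2 * t / 3 := by positivity
    have hb : 2 * t / 3 < 1 := by linarith
    have h1 := (kobayashi_le_add hzero hp hw).trans (add_le_add
      (Real.artanh_le_artanh (neg_one_lt_zero.trans_le lempert_nonneg) hs1 hl1)
      (Real.artanh_le_artanh (neg_one_lt_zero.trans_le lempert_nonneg) hb hl2))
    rw [artanh_add_artanh hs0.le hs1 ha hb] at h1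
    have h2 := tanh_le_tanh h1
    rwa [Real.tanh_artanh] at h2
    refine ⟨lt_of_lt_of_le (by norm_num) (div_nonneg (by positivity) (by positivity)), ?_⟩
    rw [div_lt_one (by positivity)]
    nlinarith
  have hk2 : (s + 2 * t / 3) / (1 + s * (2 * t / 3)) < t := by
    rw [div_lt_iff₀ (by positivity)]
    have : 0 < t * (s * (2 * t / 3)) := by positivity
    rw [hs] at this ⊢
    linarith
  refine (hk.trans_lt hk2).trans_le (hD.le_lempert hzero hw fun φ α hφ hα h0 h1 => ?_)
  have h2 := (le_norm_powerSum_translate hω hs0.le hs1.le hr0).trans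
    (norm_powerSum_le_of_disc hn0 2 hφ h0 hα h1)
  have h3 := le_of_mul_le_mul_left h2 (by positivity)
  rw [hr] at h3
  refine le_of_pow_le_pow_left₀ three_ne_zero (norm_nonneg α) (le_trans ?_ h3)
  have : t ^ 3 * 27 ≤ t ^ 3 * (4 * (2 * n + 1) * ((1 - s) ^ n) ^ 2) := by gcongr
  rw [mul_pow]
  have e : s = t / 3 := hs
  generalize ((1 - s) ^ n) ^ 2 = y at *
  rw [e]
  nlinarith

end Chain


/-! ### A symmetric function that improves on the power sum -/

/-- Since `|A - εB|² = |A|² - 2ε Re(conj A * B) + ε²|B|²`, a small positive `ε` lowers the modulus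
near the points where `|A| = N`; compactness makes `ε` uniform. -/
theorem exists_norm_sub_mul_lt {X : Type*} [MetricSpace X] {K : Set X} (hK : IsCompact K)
    {A B : X → ℂ} (hA : Continuous A) (hB : Continuous B) {N : ℝ} (hN : 0 < N)
    (hAN : ∀ x ∈ K, ‖A x‖ ≤ N) (h : ∀ x ∈ K, ‖A x‖ = N → 0 < (conj (A x) * B x).re) :
    ∃ (ε : ℝ) (M : ℝ), 0 < M ∧ M < N ∧ ∀ x ∈ K, ‖A x - ε * B x‖ < M := by
  have key : ∃ ε : ℝ, ∀ x ∈ K, ‖A x - ε * B x‖ < N := by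
    by_contra! hcon
    -- Failure for every `ε = 1/(m+1)` yields a limit point `y` with `|A y| = N` and `Re(conj (A y)
    -- * B y) ≤ 0`.
    choose x hxK hx using fun m : ℕ => hcon (1 / ((m : ℝ) + 1))
    obtain ⟨y, hyK, φ, hφ, hy⟩ := hK.tendsto_subseq hxK
    have hε : Filter.Tendsto (fun m => 1 / ((φ m : ℝ) + 1)) Filter.atTop (nhds 0) :=
      tendsto_one_div_add_atTop_nhds_zero_nat.comp hφ.tendsto_atTop
    have hAy := (hA.tendsto y).comp hy
    have hBy := (hB.tendsto y).comp hy
    have hre : (conj (A y) * B y).re ≤ 0 := by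
      have h1 : Filter.Tendsto (fun m => 2 * (conj (A (x (φ m))) * B (x (φ m))).re)
          Filter.atTop (nhds (2 * (conj (A y) * B y).re)) := by
        have hc : Continuous fun t => 2 * (conj (A t) * B t).re := by fun_prop
        exact (hc.tendsto y).comp hy
      have h2 := hε.mul (hBy.norm.pow 2)
      rw [zero_mul] at h2
      have := le_of_tendsto_of_tendsto' h1 h2 fun m => by
        have hpos : (0 : ℝ) < 1 / ((φ m : ℝ) + 1) := by positivity
        have hge := pow_le_pow_left₀ hN.le (hx (φ m)) 2
        have hle := pow_le_pow_left₀ (norm_nonneg _) (hAN _ (hxK (φ m))) 2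
        simp only [Function.comp_apply]
        generalize 1 / ((φ m : ℝ) + 1) = ε at *
        generalize A (x (φ m)) = a at *
        generalize B (x (φ m)) = b at *
        have e : ‖a - ε * b‖ ^ 2 = ‖a‖ ^ 2 - ε * (2 * (conj a * b).re) + ε * (ε * ‖b‖ ^ 2) := by
          simp only [Complex.sq_norm, Complex.normSq_apply, Complex.sub_re, Complex.sub_im,
            Complex.mul_re, Complex.mul_im, Complex.conj_re, Complex.conj_im, Complex.ofReal_re,
            Complex.ofReal_im]
          ring
        exact le_of_mul_le_mul_left (by linarith) hpos
      linarith
    have hnorm : ‖A y‖ = N := by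
      refine le_antisymm (hAN y hyK) ?_
      have h2 := hAy.norm.add (hε.mul hBy.norm)
      rw [zero_mul, add_zero] at h2
      refine ge_of_tendsto' h2 fun m => (hx (φ m)).trans ?_
      refine (norm_sub_le _ _).trans ?_
      rw [norm_mul, Complex.norm_real, Real.norm_of_nonneg (by positivity)]
      rfl
    exact (h y hyK hnorm).not_ge hre
  obtain ⟨ε, hε⟩ := key
  rcases K.eq_empty_or_nonempty with rfl | hne
  · exact ⟨ε, N / 2, by positivity, by linarith, by simp⟩
  obtain ⟨x, hxK, hx⟩ := hK.exists_isMaxOn hne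
    (f := fun x => ‖A x - ε * B x‖) (Continuous.continuousOn (by fun_prop))
  have h1 := hε x hxK
  have h0 := norm_nonneg (A x - ε * B x)
  refine ⟨ε, (‖A x - ε * B x‖ + N) / 2, by linarith, by linarith, fun y hy => ?_⟩
  have : ‖A y - ε * B y‖ ≤ ‖A x - ε * B x‖ := hx hy
  linarith

theorem eq_of_norm_sum_eq_card {n : ℕ} (hn : n ≠ 0) {a : Fin n → ℂ} (ha : ∀ i, ‖a i‖ ≤ 1)
    (h : ‖∑ i, a i‖ = n) : ∃ u : ℂ, ‖u‖ = 1 ∧ ∀ i, a i = u := by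
  have hn0 : (n : ℂ) ≠ 0 := by exact_mod_cast hn
  set u : ℂ := (∑ i, a i) / n with hu
  have hu1 : ‖u‖ = 1 := by
    rw [hu, norm_div, h, Complex.norm_natCast, div_self (by exact_mod_cast hn)]
  have huu : conj u * u = 1 := by
    rw [← Complex.normSq_eq_conj_mul_self, Complex.normSq_eq_norm_sq, hu1]; simp
  have hb1 : ∀ i, ‖conj u * a i‖ ≤ 1 := fun i => by
    rw [norm_mul, RCLike.norm_conj, hu1, one_mul]; exact ha i
  have hsum : ∑ i, (conj u * a i).re = ∑ _i : Fin n, (1 : ℝ) := by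
    rw [← Complex.re_sum, ← Finset.mul_sum, show ∑ i, a i = n * u by rw [hu]; field_simp,
      mul_left_comm, huu]
    simp
  have hre := (Finset.sum_eq_sum_iff_of_le fun i _ =>
    (Complex.re_le_norm _).trans (hb1 i)).mp hsum
  refine ⟨u, hu1, fun i => ?_⟩
  have h1 := hre i (Finset.mem_univ i)
  have h2 : (conj u * a i).im = 0 := by
    have := hb1 i
    have h3 : ‖conj u * a i‖ ^ 2 ≤ 1 := pow_le_one₀ (norm_nonneg _) this
    rw [Complex.sq_norm, Complex.normSq_apply, h1] at h3
    nlinarith [sq_nonneg (conj u * a i).im]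
  have h4 : conj u * a i = 1 := Complex.ext (by simpa using h1) (by simpa using h2)
  linear_combination u * h4 - a i * huu

/-- All `z_i / v` are `k`-th roots of unity, where `v` is one of the `z_i`. Summing `(z_i / v)^j`
over `j < k` and `i` gives `n`, as only `j = 0` survives, and also `k` times the number of `i` with
`z_i = v`. -/
theorem dvd_of_powerSum_eq_zero {n k : ℕ} (hn : n ≠ 0) (hk : k ≠ 0) {z : Fin n → ℂ} {u : ℂ}
    (hu : ‖u‖ = 1) (hz : ∀ i, z i ^ k = u) (h : ∀ j ∈ Finset.Ico 1 k, ∑ i, z i ^ j = 0) :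
    k ∣ n := by
  classical
  set v := z ⟨0, Nat.pos_of_ne_zero hn⟩ with hv
  have hy : ∀ i, (z i * conj v) ^ k = 1 := fun i => by
    rw [mul_pow, ← map_pow, hz, hv, hz, Complex.mul_conj, Complex.normSq_eq_norm_sq, hu]; simp
  have h1 : ∑ j ∈ Finset.range k, (∑ i, z i ^ j) * conj v ^ j = n := by
    rw [Finset.sum_eq_single_of_mem 0 (Finset.mem_range.mpr (Nat.pos_of_ne_zero hk))]
    · simp
    · intro j hj hj0
      rw [h j (Finset.mem_Ico.mpr ⟨Nat.pos_of_ne_zero hj0, Finset.mem_range.mp hj⟩), zero_mul]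
  have h2 : ∀ i, ∑ j ∈ Finset.range k, (z i * conj v) ^ j =
      if z i * conj v = 1 then (k : ℂ) else 0 := by
    intro i
    split_ifs with h3
    · simp [h3]
    · rw [geom_sum_eq h3, hy, sub_self, zero_div]
  simp only [Finset.sum_mul, ← mul_pow] at h1
  rw [Finset.sum_comm, Finset.sum_congr rfl fun i _ => h2 i, ← Finset.sum_filter,
    Finset.sum_const, nsmul_eq_mul] at h1
  exact ⟨_, by rw [mul_comm]; exact_mod_cast h1.symm⟩

/-- Equality forces `z_i ^ k = u` with `|u| = 1`, so `p_(k-j) = u conj(p_j)` and the product is `n ∑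
|p_j|²`. If this vanished, `k` would divide `n`. -/
theorem re_conj_powerSum_mul_pos {n k : ℕ} (hn : n ≠ 0) (hk : k ≠ 0) (hkn : ¬ k ∣ n)
    {z : Fin n → ℂ} (hz : ∀ i, ‖z i‖ ≤ 1) (h : ‖∑ i, z i ^ k‖ = n) :
    0 < (conj (∑ i, z i ^ k) *
      ∑ j ∈ Finset.Ico 1 k, (∑ i, z i ^ j) * ∑ i, z i ^ (k - j)).re := by
  obtain ⟨u, hu, hzu⟩ := eq_of_norm_sum_eq_card hn (fun i => by
    rw [norm_pow]; exact pow_le_one₀ (norm_nonneg _) (hz i)) h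
  have huu : conj u * u = 1 := by
    rw [← Complex.normSq_eq_conj_mul_self, Complex.normSq_eq_norm_sq, hu]; simp
  have hz1 : ∀ i, z i * conj (z i) = 1 := fun i => by
    have : ‖z i‖ = 1 := (pow_eq_one_iff_of_nonneg (norm_nonneg _) hk).mp (by
      rw [← norm_pow, hzu, hu])
    rw [Complex.mul_conj, Complex.normSq_eq_norm_sq, this]; simp
  have hrefl : ∀ j ∈ Finset.Ico 1 k, ∑ i, z i ^ (k - j) = u * conj (∑ i, z i ^ j) := by
    intro j hj
    rw [map_sum, Finset.mul_sum]
    refine Finset.sum_congr rfl fun i _ => ?_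
    have e : z i ^ k = z i ^ (k - j) * z i ^ j := by
      rw [← pow_add, Nat.sub_add_cancel (Finset.mem_Ico.mp hj).2.le]
    rw [← hzu i, e, mul_assoc, map_pow, ← mul_pow, hz1, one_pow, mul_one]
  have hval : conj (∑ i, z i ^ k) *
      ∑ j ∈ Finset.Ico 1 k, (∑ i, z i ^ j) * ∑ i, z i ^ (k - j) =
        ((n * ∑ j ∈ Finset.Ico 1 k, ‖∑ i, z i ^ j‖ ^ 2 : ℝ) : ℂ) := by
    have e : ∑ i, z i ^ k = n * u := by simp [hzu]
    have e2 : ∑ j ∈ Finset.Ico 1 k, (∑ i, z i ^ j) * ∑ i, z i ^ (k - j) =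
        u * ∑ j ∈ Finset.Ico 1 k, ((‖∑ i, z i ^ j‖ ^ 2 : ℝ) : ℂ) := by
      rw [Finset.mul_sum]
      refine Finset.sum_congr rfl fun j hj => ?_
      rw [hrefl j hj, mul_left_comm, Complex.mul_conj, Complex.normSq_eq_norm_sq]
    rw [e, e2, map_mul, Complex.conj_natCast]
    push_cast
    linear_combination (n * ∑ j ∈ Finset.Ico 1 k, (‖∑ i, z i ^ j‖ : ℂ) ^ 2) * huu
  rw [hval, Complex.ofReal_re]
  have hn0 : (0 : ℝ) < n := by exact_mod_cast Nat.pos_of_ne_zero hn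
  refine mul_pos hn0 (lt_of_le_of_ne (Finset.sum_nonneg fun j _ => by positivity) fun h0 => ?_)
  have h1 := (Finset.sum_eq_zero_iff_of_nonneg fun j _ => by positivity).mp h0.symm
  exact hkn (dvd_of_powerSum_eq_zero hn hk hu hzu fun j hj => by simpa using h1 j hj)

/-- If `k` does not divide `n`, then the power sum of degree `k` on `G_n` can be modified by
products of power sums of lower degree so that its supremum drops below `n`. -/
theorem exists_isHolomorphicMap_powerSum {n k : ℕ} (hn : n ≠ 0) (hk : k ≠ 0) (hkn : ¬ k ∣ n) :
    ∃ (f : (Fin n → ℂ) → ℂ) (M : ℝ), 0 < M ∧ M < n ∧ IsHolomorphicMap f (symPolydisc n) unitDisc ∧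
      ∀ z : Fin n → ℂ, (∀ j ∈ Finset.Ico 1 k, ∑ i, z i ^ j = 0) →
        f (symMap n z) = (∑ i, z i ^ k) / M := by
  choose P hPd hP using exists_powerSum n
  obtain ⟨ε, M, hM0, hMn, hM⟩ := exists_norm_sub_mul_lt
    (K := Set.univ.pi fun _ : Fin n => Metric.closedBall (0 : ℂ) 1)
    (A := fun z => ∑ i, z i ^ k)
    (B := fun z => ∑ j ∈ Finset.Ico 1 k, (∑ i, z i ^ j) * ∑ i, z i ^ (k - j))
    (isCompact_univ_pi fun _ => isCompact_closedBall 0 1) (by fun_prop) (by fun_prop)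
    (N := n) (by exact_mod_cast Nat.pos_of_ne_zero hn)
    (fun z hz => norm_powerSum_le (fun i => by simpa using hz i trivial) k)
    (fun z hz => re_conj_powerSum_mul_pos hn hk hkn fun i => by simpa using hz i trivial)
  refine ⟨fun w => (P k w - ε * ∑ j ∈ Finset.Ico 1 k, P j w * P (k - j) w) / M, M, hM0, hMn,
    ⟨?_, ?_⟩, fun z hz => ?_⟩
  · refine Differentiable.differentiableOn ?_
    have h1 : ∀ m, Differentiable ℂ (P m) := hPd
    simp only [div_eq_mul_inv]
    fun_prop
  · rintro _ ⟨z, hz, rfl⟩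
    have := hM z fun i _ => by simpa using (mem_unitDisc.mp (hz i)).le
    simp only [hP, mem_unitDisc]
    rwa [norm_div, Complex.norm_real, Real.norm_of_nonneg hM0.le, div_lt_one hM0]
  · simp only [hP]
    rw [Finset.sum_eq_zero (s := Finset.Ico 1 k) fun j hj => by rw [hz j hj, zero_mul], mul_zero,
      sub_zero]

theorem exists_mDist_lt_caratheodoryStar {k : ℕ} (hk : 2 ≤ k) :
    ∃ w ∈ symPolydisc (k + 1),
      mDist (k + 1) 0 w < caratheodoryStar (symPolydisc (k + 1)) 0 w := by
  have hk0 : k ≠ 0 := by omega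
  obtain ⟨f, M, hM0, hMn, hf, hfP⟩ := exists_isHolomorphicMap_powerSum (n := k + 1) (k := k)
    (by omega) hk0 (fun h => by
      have := (Nat.dvd_add_right (dvd_refl k)).mp h
      have := Nat.le_of_dvd one_pos this
      omega)
  push_cast at hMn
  -- This makes `n - β ^ k > M` with `n = k + 1`; `β ^ k ≤ β` lets half the gap suffice.
  obtain ⟨β, hβ0, hβ1, hβM⟩ : ∃ β : ℝ, 0 < β ∧ β < 1 ∧ β ^ k < k + 1 - M := by
    refine ⟨min (1 / 2) ((k + 1 - M) / 2), lt_min (by norm_num) (by linarith),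
      (min_le_left _ _).trans_lt (by norm_num), ?_⟩
    refine (pow_le_of_le_one (le_min (by norm_num) (by linarith))
      ((min_le_left _ _).trans (by norm_num)) hk0).trans_lt ?_
    exact (min_le_right _ _).trans_lt (by linarith)
  have hω := Complex.isPrimitiveRoot_exp k hk0
  set ω := Complex.exp (2 * Real.pi * Complex.I / k)
  have hβn : ‖(β : ℂ)‖ = β := by rw [Complex.norm_real, Real.norm_of_nonneg hβ0.le]
  -- Power sums of degree `1, …, k - 1` vanish here, so the correction term in `f` drops out and `f
  -- = p_k / M`.
  set z : Fin (k + 1) → ℂ := Fin.cons 0 fun i : Fin k => ω ^ (i : ℕ) * β with hz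
  have hzD : symMap (k + 1) z ∈ symPolydisc (k + 1) := by
    refine ⟨z, fun i => mem_unitDisc.mpr ?_, rfl⟩
    refine Fin.cases (by simp [hz]) (fun i => ?_) i
    rw [hz, Fin.cons_succ]
    exact norm_root_mul_lt_one hk0 hω (by rwa [hβn]) i
  have hpow : ∀ j, j ≠ 0 → ∑ i, z i ^ j = (if k ∣ j then (k : ℂ) else 0) * (β : ℂ) ^ j := by
    intro j hj
    rw [Fin.sum_univ_succ, ← sum_rootsOfUnity_pow hω, Finset.sum_mul]
    simp [hz, hj, mul_pow]
  have hp : ∀ t : ℂ, ∏ i, (1 + z i * t) =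
      (1 - Polynomial.C ((-β : ℂ) ^ k) * Polynomial.X ^ k : Polynomial ℂ).eval t := by
    intro t
    have := prod_sub_rootsOfUnity_mul hk0 hω 1 (-β * t)
    rw [Fin.prod_univ_succ]
    simp only [hz, Fin.cons_zero, Fin.cons_succ, zero_mul, add_zero, one_mul]
    simp only [Polynomial.eval_sub, Polynomial.eval_one, Polynomial.eval_C_mul,
      Polynomial.eval_X_pow]
    rw [← mul_pow, ← one_pow (M := ℂ) k, ← this, one_pow]
    exact Finset.prod_congr rfl fun i _ => by ring
  have hβk1 : β ^ k < 1 := pow_lt_one₀ hβ0.le hβ1 hk0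
  have hm : mDist (k + 1) 0 (symMap (k + 1) z) ≤ k * β ^ k / (k + 1 - β ^ k) := by
    have : Nonempty (Metric.sphere (0 : ℂ) 1) := ⟨⟨1, by simp⟩⟩
    refine ciSup_le fun l => ?_
    have hl : ‖(l : ℂ)‖ = 1 := by simp
    generalize (l : ℂ) = l at hl
    rw [testFun_zero, moebiusDist_zero_left, testFun_symMap l hp, norm_div]
    have hder : (1 - Polynomial.C ((-β : ℂ) ^ k) * Polynomial.X ^ k : Polynomial ℂ).derivative.eval l
        = -(k * (-β : ℂ) ^ k * l ^ (k - 1)) := by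
      generalize (-β : ℂ) ^ k = c
      simp only [Polynomial.derivative_sub, Polynomial.derivative_one,
        Polynomial.derivative_C_mul_X_pow, Polynomial.eval_sub, Polynomial.eval_zero,
        Polynomial.eval_C_mul, Polynomial.eval_X_pow]
      ring
    have hlk : l * l ^ (k - 1) = l ^ k := by rw [← pow_succ', Nat.sub_add_cancel (by omega)]
    have hden : ((k + 1 : ℕ) : ℂ) *
        (1 - Polynomial.C ((-β : ℂ) ^ k) * Polynomial.X ^ k : Polynomial ℂ).eval l -
          l * (-(k * (-β : ℂ) ^ k * l ^ (k - 1))) = ((k + 1 : ℕ) : ℂ) - (-β : ℂ) ^ k * l ^ k := by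
      simp only [Polynomial.eval_sub, Polynomial.eval_one, Polynomial.eval_C_mul,
        Polynomial.eval_X_pow]
      rw [← hlk]
      push_cast
      ring
    rw [hder, hden]
    have h1 : ‖-(k * (-β : ℂ) ^ k * l ^ (k - 1))‖ = k * β ^ k := by
      simp [hl, abs_of_pos hβ0]
    have h2 : k + 1 - β ^ k ≤ ‖((k + 1 : ℕ) : ℂ) - (-β : ℂ) ^ k * l ^ k‖ := by
      refine le_trans (le_of_eq ?_) (norm_sub_norm_le _ _)
      rw [Complex.norm_natCast, norm_mul, norm_pow, norm_pow, norm_neg, hβn, hl]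
      simp
    rw [h1]
    have : 0 < k + 1 - β ^ k := by linarith
    gcongr
  refine ⟨_, hzD, hm.trans_lt ?_⟩
  have hc := moebiusDist_le_caratheodoryStar (zero_mem_symPolydisc (k + 1)) hzD hf
  have hf0 : f 0 = 0 := by
    have := hfP 0 fun j hj => by simp [Nat.one_le_iff_ne_zero.mp (Finset.mem_Ico.mp hj).1]
    simpa [symMap_zero, hk0] using this
  have hfz : f (symMap (k + 1) z) = k * (β : ℂ) ^ k / M := by
    rw [hfP z fun j hj => ?_, hpow k hk0, if_pos dvd_rfl]
    have hj' := Finset.mem_Ico.mp hj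
    rw [hpow j (by omega), if_neg fun h => by
      have := Nat.le_of_dvd (by omega) h
      omega, zero_mul]
  rw [hf0, moebiusDist_zero_left, hfz, norm_div, norm_mul, norm_pow, hβn, Complex.norm_natCast,
    Complex.norm_real, Real.norm_of_nonneg hM0.le] at hc
  refine lt_of_lt_of_le ?_ hc
  have : 0 < (k : ℝ) * β ^ k := by positivity
  exact div_lt_div_of_pos_left this hM0 (by linarith)

end SymPolydisc

end

/-! ### Assembly of the chain of inequalities -/

open SymPolydisc in
theorem corollaryi (n : ℕ) (hn : 3 ≤ n) :
    ((∀ w ∈ symPolydisc n, kobayashiStar (symPolydisc n) 0 w ≤ lempert (symPolydisc n) 0 w) ∧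
      ∃ w ∈ symPolydisc n, kobayashiStar (symPolydisc n) 0 w < lempert (symPolydisc n) 0 w) ∧
    (∀ w ∈ symPolydisc n,
      caratheodoryStar (symPolydisc n) 0 w ≤ kobayashiStar (symPolydisc n) 0 w) ∧
    ((∀ w ∈ symPolydisc n, mDist n 0 w ≤ caratheodoryStar (symPolydisc n) 0 w) ∧
      ∃ w ∈ symPolydisc n, mDist n 0 w < caratheodoryStar (symPolydisc n) 0 w) ∧
    ¬ MemLempertClass (symPolydisc n) := by
  have hD := discConnected_symPolydisc n
  have h0 := zero_mem_symPolydisc n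
  refine ⟨⟨fun w hw => hD.kobayashiStar_le_lempert h0 hw, exists_kobayashiStar_lt_lempert hn⟩,
    fun w hw => hD.caratheodoryStar_le_kobayashiStar h0 hw,
    ⟨fun w hw => mDist_le_caratheodoryStar (by omega) h0 hw, ?_⟩, fun h => ?_⟩
  · obtain ⟨k, rfl⟩ := Nat.exists_eq_add_of_le' (show 1 ≤ n by omega)
    exact exists_mDist_lt_caratheodoryStar (by omega)
  -- Equality `l = c*` would force `l ≤ k*` everywhere.
  · obtain ⟨w, hw, hlt⟩ := exists_kobayashiStar_lt_lempert hn
    rw [h 0 h0 w hw] at hlt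
    exact hlt.not_ge (hD.caratheodoryStar_le_kobayashiStar h0 hw)
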